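/- Let $(E,\|\cdot\|_E)$ be an infinite-dimensional real Banach space with an unconditional Schauder basis $(e_n)_{n\in\mathbb N}$. Suppose that $E$ admits an equivalent norm $\|\cdot\|$ that is of class $C^1$ on $E\setminus\{0\}$ and locally depends on finitely many coordinates, that is, for every $x\in E\setminus\{0\}$ there are an open neighbourhood $V$ of $x$, finitely many continuous linear functionals $L_1,\dots,L_l\in E^*$ and a function $\gamma:\mathbb R^l\to\mathbb R$ with $\|y\|=\gamma(L_1(y),\dots,L_l(y))$ for all $y\in V$. Let $f:E\to\mathbb R^d$ be a $C^1$ map, let $\varepsilon:E\to(0,\infty)$ be continuous, and let $U\subseteq E$ be an open set that contains the critical set $C_f=\{x\in E: Df(x):E\to\mathbb R^d \text{ is not surjective}\}$. Then there exists a $C^1$ map $\varphi:E\to\mathbb R^d$ such that 1. $|f(x)-\varphi(x)|\le\varepsilon(x)$ for all $x\in E$, where $|\cdot|$ is the Euclidean norm; 2. $f(x)=\varphi(x)$ for all $x\in E\setminus U$; 3. $\|Df(x)-D\varphi(x)\|\le\varepsilon(x)$ for all $x\in E$, where $\|\cdot\|$ is the operator norm from $(E,\|\cdot\|_E)$ to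 $(\mathbb R^d,|\cdot|)$; 4. $D\varphi(x)$ is surjective for all $x\in E$. -/

import Mathlib

section

variable {E : Type*} [NormedAddCommGroup E] [NormedSpace ℝ E]

/-- `p` is a norm on `E` equivalent to the given one: `c ‖x‖ ≤ p x ≤ C ‖x‖` for some
constants `c, C > 0`. -/
def IsEquivalentNorm (p : Seminorm ℝ E) : Prop :=
  ∃ c C : ℝ, 0 < c ∧ 0 < C ∧ ∀ x : E, c * ‖x‖ ≤ p x ∧ p x ≤ C * ‖x‖

/-- The norm `p` is of class `C¹`, which for a norm means: on `E \ {0}`. -/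
def IsC1Norm (p : Seminorm ℝ E) : Prop :=
  ContDiffOn ℝ 1 p {0}ᶜ

/-- The norm `p` locally depends on finitely many coordinates: near every `x ≠ 0` it is a function
of the values of finitely many continuous linear functionals. (The origin has to be left out: near
`0` no norm on an infinite-dimensional space depends on finitely many functionals.) -/
def LocallyDependsOnFinitelyManyCoordinates (p : Seminorm ℝ E) : Prop :=
  ∀ x : E, x ≠ 0 → ∃ (l : ℕ) (V : Set E) (L : Fin l → StrongDual ℝ E) (γ : (Fin l → ℝ) → ℝ),
    IsOpen V ∧ x ∈ V ∧ ∀ y ∈ V, p y = γ (fun i => L i y)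

/-- The set of critical points of `f`: the points where the Fréchet derivative is not surjective. -/
def criticalSet {F : Type*} [NormedAddCommGroup F] [NormedSpace ℝ F] (f : E → F) : Set E :=
  {x | ¬ Function.Surjective (fderiv ℝ f x)}

end

/-!
Along an unconditional basis of a space with a smooth norm of this kind, damping each basis tail by
a cutoff of that tail yields `C¹` maps with uniformly bounded derivatives, uniformly close to the
identity, that locally depend on finitely many functionals. Hence `f` has fine `C¹` approximations
`g` that locally depend on finitely many functionals, and since `E` is Lindelöf only countably many
functionals are involved.

By Baire, the dual of `E` is not spanned by countably many functionals together with finitely many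
others, so there is an operator `T` from `E` to the target that is onto on the common kernel of any
finitely many of these functionals. On such a kernel `Dg` vanishes, and adding a small multiple of
`T` to `g`, with a factor of the same kind, makes every derivative onto without spoiling the
approximation. On `U` this is done with a tolerance that vanishes quadratically at the boundary, so
that the perturbed map continues as a `C¹` map by `f` outside `U`, where `Df` is onto.
-/

open Filter Topology Set

section FinitelyDetermined

variable {E F G H : Type*} [NormedAddCommGroup E] [NormedSpace ℝ E]

/-- Near `x`, the map `g` is a function of finitely many of the functionals in `S`; the function
itself is not named: `g` takes equal values wherever these functionals do. -/
def FinitelyDeterminedAt (S : Set (StrongDual ℝ E)) (g : E → F) (x : E) : Prop :=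
  ∃ A : Finset (StrongDual ℝ E), ↑A ⊆ S ∧
    ∃ V ∈ 𝓝 x, ∀ y ∈ V, ∀ z ∈ V, (∀ L ∈ A, L y = L z) → g y = g z

namespace FinitelyDeterminedAt

variable {S : Set (StrongDual ℝ E)} {g : E → F} {x : E}

theorem const (c : F) : FinitelyDeterminedAt S (fun _ ↦ c) x :=
  ⟨∅, by simp, univ, univ_mem, fun _ _ _ _ _ ↦ rfl⟩

theorem map (hg : FinitelyDeterminedAt S g x) (k : F → H) :
    FinitelyDeterminedAt S (fun y ↦ k (g y)) x := by
  obtain ⟨A, hA, V, hV, hgV⟩ := hg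
  exact ⟨A, hA, V, hV, fun y hy z hz hL ↦ congrArg k (hgV y hy z hz hL)⟩

theorem map₂ {g' : E → G} (hg : FinitelyDeterminedAt S g x) (hg' : FinitelyDeterminedAt S g' x)
    (k : F → G → H) : FinitelyDeterminedAt S (fun y ↦ k (g y) (g' y)) x := by
  classical
  obtain ⟨A, hA, V, hV, hgV⟩ := hg
  obtain ⟨A', hA', V', hV', hgV'⟩ := hg'
  refine ⟨A ∪ A', by simp [hA, hA'], V ∩ V', inter_mem hV hV', fun y hy z hz hL ↦ ?_⟩
  exact congrArg₂ k (hgV y hy.1 z hz.1 fun L hLA ↦ hL L (Finset.mem_union_left _ hLA))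
    (hgV' y hy.2 z hz.2 fun L hLA ↦ hL L (Finset.mem_union_right _ hLA))

theorem congr {g' : E → F} (hg : FinitelyDeterminedAt S g x) (h : g' =ᶠ[𝓝 x] g) :
    FinitelyDeterminedAt S g' x := by
  obtain ⟨A, hA, V, hV, hgV⟩ := hg
  refine ⟨A, hA, V ∩ {y | g' y = g y}, inter_mem hV h, fun y hy z hz hL ↦ ?_⟩
  rw [hy.2, hz.2, hgV y hy.1 z hz.1 hL]

theorem sum [AddCommMonoid F] {ι : Type*} (s : Finset ι) {u : ι → E → F}
    (hu : ∀ i ∈ s, FinitelyDeterminedAt S (u i) x) :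
    FinitelyDeterminedAt S (fun y ↦ ∑ i ∈ s, u i y) x := by
  classical
  induction s using Finset.induction_on with
  | empty => simpa only [Finset.sum_empty] using const (0 : F)
  | insert i s hi ih =>
    simp only [Finset.sum_insert hi]
    exact (hu i (Finset.mem_insert_self _ _)).map₂
      (ih fun j hj ↦ hu j (Finset.mem_insert_of_mem hj)) (· + ·)

theorem continuousLinearMap [NormedAddCommGroup F] [NormedSpace ℝ F] [FiniteDimensional ℝ F]
    (T : E →L[ℝ] F) : FinitelyDeterminedAt univ T x := by
  classical
  let e := Module.finBasis ℝ F
  refine ⟨Finset.univ.image fun i ↦ (e.coord i).toContinuousLinearMap ∘L T, subset_univ _,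
    univ, univ_mem, fun y _ z _ hL ↦ e.ext_elem fun i ↦ ?_⟩
  exact hL _ (Finset.mem_image_of_mem _ (Finset.mem_univ i))

theorem comp_continuousLinearMap [NormedAddCommGroup G] [NormedSpace ℝ G] {g : G → F}
    (T : E →L[ℝ] G) (hg : FinitelyDeterminedAt univ g (T x)) :
    FinitelyDeterminedAt univ (fun y ↦ g (T y)) x := by
  classical
  obtain ⟨A, -, V, hV, hgV⟩ := hg
  refine ⟨A.image (· ∘L T), subset_univ _, T ⁻¹' V, T.continuous.continuousAt hV,
    fun y hy z hz hL ↦ hgV _ hy _ hz fun L hLA ↦ ?_⟩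
  exact hL (L ∘L T) (Finset.mem_image_of_mem _ hLA)

theorem comp_sub_const (a : E) (hg : FinitelyDeterminedAt S g (x - a)) :
    FinitelyDeterminedAt S (fun y ↦ g (y - a)) x := by
  obtain ⟨A, hA, V, hV, hgV⟩ := hg
  have hcont : Continuous fun y ↦ y - a := by fun_prop
  refine ⟨A, hA, (· - a) ⁻¹' V, hcont.continuousAt hV,
    fun y hy z hz hL ↦ hgV _ hy _ hz fun L hLA ↦ ?_⟩
  rw [map_sub, map_sub, hL L hLA]

theorem exists_eventually_add_smul_eq (hg : FinitelyDeterminedAt S g x) :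
    ∃ A : Finset (StrongDual ℝ E), ↑A ⊆ S ∧ ∀ v : E, (∀ L ∈ A, L v = 0) →
      ∀ᶠ t : ℝ in 𝓝 0, g (x + t • v) = g x := by
  obtain ⟨A, hA, V, hV, hgV⟩ := hg
  refine ⟨A, hA, fun v hv ↦ ?_⟩
  have hline : Tendsto (fun t : ℝ ↦ x + t • v) (𝓝 0) (𝓝 x) :=
    Continuous.tendsto' (by fun_prop) _ _ (by simp)
  filter_upwards [hline hV] with t ht
  exact hgV _ ht _ (mem_of_mem_nhds hV) fun L hLA ↦ by simp [hv L hLA]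

theorem exists_countable [SecondCountableTopology E] {U : Set E}
    (hg : ∀ x ∈ U, FinitelyDeterminedAt univ g x) :
    ∃ S : Set (StrongDual ℝ E), S.Countable ∧ ∀ x ∈ U, FinitelyDeterminedAt S g x := by
  choose! A _ V hV hgV using hg
  obtain ⟨s, hsU, hs, hcover⟩ := TopologicalSpace.countable_cover_nhdsWithin
    fun x hx ↦ mem_nhdsWithin_of_mem_nhds (interior_mem_nhds.2 (hV x hx))
  refine ⟨⋃ x ∈ s, A x, hs.biUnion fun x _ ↦ (A x).countable_toSet, fun y hy ↦ ?_⟩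
  obtain ⟨x, hxs, hyx⟩ := mem_iUnion₂.1 (hcover hy)
  exact ⟨A x, subset_biUnion_of_mem (u := fun x ↦ (A x : Set (StrongDual ℝ E))) hxs, V x,
    mem_interior_iff_mem_nhds.1 hyx, hgV x (hsU hxs)⟩

end FinitelyDeterminedAt

theorem LocallyDependsOnFinitelyManyCoordinates.finitelyDeterminedAt {p : Seminorm ℝ E}
    (hp : LocallyDependsOnFinitelyManyCoordinates p) {x : E} (hx : x ≠ 0) :
    FinitelyDeterminedAt univ p x := by
  classical
  obtain ⟨l, V, L, γ, hV, hxV, hγ⟩ := hp x hx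
  refine ⟨Finset.univ.image L, subset_univ _, V, hV.mem_nhds hxV, fun y hy z hz hL ↦ ?_⟩
  rw [hγ y hy, hγ z hz]
  exact congrArg γ (funext fun i ↦ hL _ (Finset.mem_image_of_mem _ (Finset.mem_univ i)))

end FinitelyDetermined

section NormBump

variable {E : Type*} [NormedAddCommGroup E] [NormedSpace ℝ E] {p : Seminorm ℝ E} {r : ℝ} {x : E}

namespace IsEquivalentNorm

theorem exists_lipschitzWith (hp : IsEquivalentNorm p) : ∃ C : NNReal, LipschitzWith C p := by
  obtain ⟨c, C, -, hC, hpC⟩ := hp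
  refine ⟨C.toNNReal, LipschitzWith.of_dist_le_mul fun x y ↦ ?_⟩
  rw [Real.coe_toNNReal _ hC.le, Real.dist_eq, dist_eq_norm]
  exact (abs_sub_map_le_sub p x y).trans (hpC (x - y)).2

theorem continuous (hp : IsEquivalentNorm p) : Continuous p :=
  hp.exists_lipschitzWith.choose_spec.continuous

end IsEquivalentNorm

/-- A smooth bump on the line, equal to `1` on `[-1, 1]` and to `0` outside `(-2, 2)`. -/
noncomputable def lineBump : ContDiffBump (0 : ℝ) :=
  ⟨1, 2, one_pos, one_lt_two⟩

/-- The cutoff around the origin that is `1` where `p x ≤ r` and `0` where `p x ≥ 2 r`. -/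
noncomputable def normBump (p : Seminorm ℝ E) (r : ℝ) (x : E) : ℝ :=
  lineBump (p x / r)

namespace normBump

theorem nonneg : 0 ≤ normBump p r x :=
  ContDiffBump.nonneg _

theorem le_one : normBump p r x ≤ 1 :=
  ContDiffBump.le_one _

theorem eq_one (hr : 0 < r) (hx : p x ≤ r) : normBump p r x = 1 := by
  refine ContDiffBump.one_of_mem_closedBall _ ?_
  rw [mem_closedBall_zero_iff, Real.norm_of_nonneg (by positivity)]
  exact (div_le_one hr).2 hx

theorem eq_zero (hr : 0 < r) (hx : 2 * r ≤ p x) : normBump p r x = 0 := by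
  refine ContDiffBump.zero_of_le_dist _ ?_
  rw [dist_zero_right, Real.norm_of_nonneg (by positivity)]
  exact (le_div_iff₀ hr).2 hx

theorem eventuallyEq_one (hp : IsEquivalentNorm p) (hx : p x < r) :
    normBump p r =ᶠ[𝓝 x] fun _ ↦ 1 := by
  filter_upwards [hp.continuous.continuousAt.eventually_lt_const hx] with y hy
  exact eq_one ((apply_nonneg p y).trans_lt hy) hy.le

theorem eventuallyEq_zero (hp : IsEquivalentNorm p) (hr : 0 < r) (hx : 2 * r < p x) :
    normBump p r =ᶠ[𝓝 x] fun _ ↦ 0 := by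
  filter_upwards [hp.continuous.continuousAt.eventually_const_lt hx] with y hy
  exact eq_zero hr hy.le

theorem ne_zero_of_le (hr : 0 < r) (hx : r ≤ p x) : x ≠ 0 := by
  rintro rfl
  exact (hr.trans_le hx).ne' (map_zero p)

theorem contDiff (hp : IsEquivalentNorm p) (hC1 : IsC1Norm p) (hr : 0 < r) :
    ContDiff ℝ 1 (normBump p r) := by
  refine contDiff_iff_contDiffAt.2 fun x ↦ ?_
  rcases lt_or_ge (p x) r with hx | hx
  · exact contDiffAt_const.congr_of_eventuallyEq (eventuallyEq_one hp hx)
  · have hpx : ContDiffAt ℝ 1 p x :=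
      hC1.contDiffAt (isOpen_compl_singleton.mem_nhds (ne_zero_of_le hr hx))
    exact (ContDiffBump.contDiff _).contDiffAt.comp x (hpx.div_const r)

theorem finitelyDeterminedAt (hp : IsEquivalentNorm p)
    (hfin : LocallyDependsOnFinitelyManyCoordinates p) (hr : 0 < r) (x : E) :
    FinitelyDeterminedAt univ (normBump p r) x := by
  rcases lt_or_ge (p x) r with hx | hx
  · exact (FinitelyDeterminedAt.const 1).congr (eventuallyEq_one hp hx)
  · exact (hfin.finitelyDeterminedAt (ne_zero_of_le hr hx)).map fun t ↦ lineBump (t / r)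

theorem exists_abs_sub_le (hp : IsEquivalentNorm p) :
    ∃ C : ℝ, 0 ≤ C ∧ ∀ r > 0, ∀ x y : E,
      |normBump p r x - normBump p r y| ≤ C / r * ‖x - y‖ := by
  obtain ⟨C₁, hC₁⟩ := ContDiff.lipschitzWith_of_hasCompactSupport lineBump.hasCompactSupport
    (lineBump.contDiff (n := 1)) (by simp)
  obtain ⟨C₂, hC₂⟩ := hp.exists_lipschitzWith
  refine ⟨C₁ * C₂, by positivity, fun r hr x y ↦ ?_⟩
  calc |lineBump (p x / r) - lineBump (p y / r)|
      ≤ C₁ * |p x / r - p y / r| := hC₁.dist_le_mul _ _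
    _ = C₁ * (|p x - p y| / r) := by rw [← sub_div, abs_div, abs_of_pos hr]
    _ ≤ C₁ * (C₂ * ‖x - y‖ / r) := by
        gcongr
        exact (hC₂.dist_le_mul x y).trans_eq (by rw [dist_eq_norm])
    _ = C₁ * C₂ / r * ‖x - y‖ := by ring

end normBump

end NormBump

section Cutoff

variable {E : Type*} [NormedAddCommGroup E] [NormedSpace ℝ E]

/-- The functions from which partitions of unity are built: `[0, 1]`-valued, of class `C¹` with
bounded derivative, and locally depending on finitely many functionals. -/
structure IsFinitelyDeterminedCutoff (χ : E → ℝ) : Prop where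
  contDiff : ContDiff ℝ 1 χ
  finitelyDeterminedAt : ∀ x, FinitelyDeterminedAt univ χ x
  nonneg : ∀ x, 0 ≤ χ x
  le_one : ∀ x, χ x ≤ 1
  exists_norm_fderiv_le : ∃ M : ℝ, ∀ x, ‖fderiv ℝ χ x‖ ≤ M

namespace IsFinitelyDeterminedCutoff

variable {χ η : E → ℝ}

theorem one : IsFinitelyDeterminedCutoff fun _ : E ↦ 1 where
  contDiff := contDiff_const
  finitelyDeterminedAt _ := .const 1
  nonneg _ := zero_le_one
  le_one _ := le_rfl
  exists_norm_fderiv_le := ⟨0, by simp⟩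

theorem one_sub (hχ : IsFinitelyDeterminedCutoff χ) :
    IsFinitelyDeterminedCutoff fun y ↦ 1 - χ y where
  contDiff := contDiff_const.sub hχ.contDiff
  finitelyDeterminedAt x := (hχ.finitelyDeterminedAt x).map (1 - ·)
  nonneg x := sub_nonneg.2 (hχ.le_one x)
  le_one x := sub_le_self 1 (hχ.nonneg x)
  exists_norm_fderiv_le := by
    obtain ⟨M, hM⟩ := hχ.exists_norm_fderiv_le
    exact ⟨M, fun x ↦ by simpa only [fderiv_const_sub, norm_neg] using hM x⟩

theorem mul (hχ : IsFinitelyDeterminedCutoff χ) (hη : IsFinitelyDeterminedCutoff η) :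
    IsFinitelyDeterminedCutoff fun y ↦ χ y * η y where
  contDiff := hχ.contDiff.mul hη.contDiff
  finitelyDeterminedAt x := (hχ.finitelyDeterminedAt x).map₂ (hη.finitelyDeterminedAt x) (· * ·)
  nonneg x := mul_nonneg (hχ.nonneg x) (hη.nonneg x)
  le_one x := mul_le_one₀ (hχ.le_one x) (hη.nonneg x) (hη.le_one x)
  exists_norm_fderiv_le := by
    obtain ⟨M, hM⟩ := hχ.exists_norm_fderiv_le
    obtain ⟨M', hM'⟩ := hη.exists_norm_fderiv_le
    refine ⟨M' + M, fun x ↦ ?_⟩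
    rw [fderiv_fun_mul (hχ.contDiff.differentiable one_ne_zero x)
      (hη.contDiff.differentiable one_ne_zero x)]
    refine norm_add_le_of_le ?_ ?_ <;> rw [norm_smul, Real.norm_eq_abs]
    · rw [abs_of_nonneg (hχ.nonneg x)]
      exact (mul_le_of_le_one_left (norm_nonneg _) (hχ.le_one x)).trans (hM' x)
    · rw [abs_of_nonneg (hη.nonneg x)]
      exact (mul_le_of_le_one_left (norm_nonneg _) (hη.le_one x)).trans (hM x)

theorem prod {ι : Type*} {χ : ι → E → ℝ} (s : Finset ι)
    (hχ : ∀ i ∈ s, IsFinitelyDeterminedCutoff (χ i)) :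
    IsFinitelyDeterminedCutoff fun y ↦ ∏ i ∈ s, χ i y := by
  classical
  induction s using Finset.induction_on with
  | empty => simpa only [Finset.prod_empty] using one
  | insert i s hi ih =>
    simp only [Finset.prod_insert hi]
    exact (hχ i (Finset.mem_insert_self _ _)).mul
      (ih fun j hj ↦ hχ j (Finset.mem_insert_of_mem hj))

end IsFinitelyDeterminedCutoff

/-- Every neighbourhood of every point supports a function with `IsFinitelyDeterminedCutoff` that is
`1` near the point. -/
def HasFinitelyDeterminedCutoffs (E : Type*) [NormedAddCommGroup E] [NormedSpace ℝ E] : Prop :=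
  ∀ (a : E), ∀ V ∈ 𝓝 a, ∃ χ : E → ℝ, IsFinitelyDeterminedCutoff χ ∧
    χ =ᶠ[𝓝 a] (fun _ ↦ 1) ∧ ∀ x ∉ V, χ =ᶠ[𝓝 x] fun _ ↦ 0

theorem isFinitelyDeterminedCutoff_normBump_sub {p : Seminorm ℝ E} (hp : IsEquivalentNorm p)
    (hC1 : IsC1Norm p) (hfin : LocallyDependsOnFinitelyManyCoordinates p) {r : ℝ} (hr : 0 < r)
    (a : E) : IsFinitelyDeterminedCutoff fun x ↦ normBump p r (x - a) where
  contDiff := (normBump.contDiff hp hC1 hr).comp (contDiff_id.sub contDiff_const)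
  finitelyDeterminedAt x := (normBump.finitelyDeterminedAt hp hfin hr (x - a)).comp_sub_const a
  nonneg _ := normBump.nonneg
  le_one _ := normBump.le_one
  exists_norm_fderiv_le := by
    obtain ⟨C, hC, hlip⟩ := normBump.exists_abs_sub_le hp
    refine ⟨C / r, fun x ↦ norm_fderiv_le_of_lip' ℝ (by positivity) (.of_forall fun y ↦ ?_)⟩
    exact (hlip r hr (y - a) (x - a)).trans_eq (by rw [sub_sub_sub_cancel_right])

theorem hasFinitelyDeterminedCutoffs {p : Seminorm ℝ E} (hp : IsEquivalentNorm p)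
    (hC1 : IsC1Norm p) (hfin : LocallyDependsOnFinitelyManyCoordinates p) :
    HasFinitelyDeterminedCutoffs E := by
  intro a V hV
  have ⟨c, _, hc, _, hcp⟩ := hp
  obtain ⟨s, hs, hsV⟩ := Metric.mem_nhds_iff.1 hV
  have hr : 0 < c * s / 3 := by positivity
  have hsub (x : E) : Tendsto (· - a) (𝓝 x) (𝓝 (x - a)) :=
    (continuous_id.sub continuous_const).tendsto x
  refine ⟨_, isFinitelyDeterminedCutoff_normBump_sub hp hC1 hfin hr a,
    (hsub a).eventually (normBump.eventuallyEq_one hp (by simpa using hr)), fun x hx ↦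
      (hsub x).eventually (normBump.eventuallyEq_zero hp hr ?_)⟩
  have hxs : s ≤ ‖x - a‖ := by
    rw [← dist_eq_norm]
    exact not_lt.1 fun hlt ↦ hx (hsV hlt)
  calc 2 * (c * s / 3) < c * s := by linarith
    _ ≤ c * ‖x - a‖ := by gcongr
    _ ≤ p (x - a) := (hcp _).1

end Cutoff

section Partition

variable {E F : Type*} [NormedAddCommGroup E] [NormedSpace ℝ E]

/-- `ψ` is a partition of unity on `U`, locally finite there, made of cutoffs with `ψ n` supported
in `V n`. -/
structure IsFinitelyDeterminedPartition (U : Set E) (V : ℕ → Set E) (ψ : ℕ → E → ℝ) : Prop where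
  isCutoff : ∀ n, IsFinitelyDeterminedCutoff (ψ n)
  eventuallyEq_zero : ∀ n, ∀ x ∉ V n, ψ n =ᶠ[𝓝 x] fun _ ↦ 0
  exists_eventually_sum_eq_one : ∀ x ∈ U, ∃ N, ∀ᶠ y in 𝓝 x,
    (∀ n ≥ N, ψ n y = 0) ∧ ∑ n ∈ Finset.range N, ψ n y = 1

theorem sum_range_prod_one_sub_mul {R : Type*} [CommRing R] (a : ℕ → R) (N : ℕ) :
    ∑ n ∈ Finset.range N, (∏ j ∈ Finset.range n, (1 - a j)) * a n =
      1 - ∏ n ∈ Finset.range N, (1 - a n) := by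
  induction N with
  | zero => simp
  | succ N ih => rw [Finset.sum_range_succ, ih, Finset.prod_range_succ]; ring

theorem HasFinitelyDeterminedCutoffs.exists_partition [SecondCountableTopology E]
    (hcut : HasFinitelyDeterminedCutoffs E) {U : Set E} (hU : U.Nonempty) {V : E → Set E}
    (hV : ∀ x ∈ U, V x ∈ 𝓝 x) :
    ∃ (a : ℕ → E) (ψ : ℕ → E → ℝ), (∀ n, a n ∈ U) ∧
      IsFinitelyDeterminedPartition U (fun n ↦ V (a n)) ψ := by
  choose! χ hχ hχ_one hχ_zero using fun x (hx : x ∈ U) ↦ hcut x (V x) (hV x hx)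
  obtain ⟨s, hsU, hs, hcover⟩ := TopologicalSpace.countable_cover_nhdsWithin
    (f := fun x ↦ {y | χ x =ᶠ[𝓝 y] fun _ ↦ 1})
    fun x hx ↦ mem_nhdsWithin_of_mem_nhds (eventually_eventually_nhds.2 (hχ_one x hx))
  have hs_nonempty : s.Nonempty := by
    obtain ⟨x, hx⟩ := hU
    obtain ⟨a, has, -⟩ := mem_iUnion₂.1 (hcover hx)
    exact ⟨a, has⟩
  obtain ⟨a, rfl⟩ := hs.exists_eq_range hs_nonempty
  have haU (n : ℕ) : a n ∈ U := hsU (mem_range_self n)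
  refine ⟨a, fun n y ↦ (∏ j ∈ Finset.range n, (1 - χ (a j) y)) * χ (a n) y, haU,
    ⟨fun n ↦ ?_, fun n x hx ↦ ?_, fun x hx ↦ ?_⟩⟩
  · exact (IsFinitelyDeterminedCutoff.prod _ fun j _ ↦ (hχ _ (haU j)).one_sub).mul (hχ _ (haU n))
  · filter_upwards [hχ_zero _ (haU n) x hx] with y hy
    rw [hy, mul_zero]
  · obtain ⟨-, ⟨N, rfl⟩, hN⟩ := mem_iUnion₂.1 (hcover hx)
    refine ⟨N + 1, hN.mono fun y hy ↦ ?_⟩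
    have hprod (n : ℕ) (hn : N < n) : ∏ j ∈ Finset.range n, (1 - χ (a j) y) = 0 :=
      Finset.prod_eq_zero (Finset.mem_range.2 hn) (by rw [hy, sub_self])
    refine ⟨fun n hn ↦ by rw [hprod n hn, zero_mul], ?_⟩
    rw [sum_range_prod_one_sub_mul, hprod _ N.lt_succ_self, sub_zero]

namespace IsFinitelyDeterminedPartition

variable [NormedAddCommGroup F] [NormedSpace ℝ F] {U : Set E} {V : ℕ → Set E} {ψ : ℕ → E → ℝ}
  {u : ℕ → E → F} {x : E}

theorem apply_eq_zero (hψ : IsFinitelyDeterminedPartition U V ψ) {n : ℕ} (hx : x ∉ V n) :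
    ψ n x = 0 :=
  (hψ.eventuallyEq_zero n x hx).eq_of_nhds

theorem exists_eventually_tsum_smul_eq (hψ : IsFinitelyDeterminedPartition U V ψ) (hx : x ∈ U)
    (u : ℕ → E → F) :
    ∃ N, ∀ᶠ y in 𝓝 x, ∑ n ∈ Finset.range N, ψ n y = 1 ∧
      ∑' n, ψ n y • u n y = ∑ n ∈ Finset.range N, ψ n y • u n y := by
  obtain ⟨N, hN⟩ := hψ.exists_eventually_sum_eq_one x hx
  refine ⟨N, hN.mono fun y hy ↦ ⟨hy.2, tsum_eq_sum fun n hn ↦ ?_⟩⟩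
  rw [hy.1 n (by simpa using hn), zero_smul]

theorem contDiffAt_tsum_smul (hψ : IsFinitelyDeterminedPartition U V ψ) (hx : x ∈ U)
    (hu : ∀ n, ContDiffAt ℝ 1 (u n) x) : ContDiffAt ℝ 1 (fun y ↦ ∑' n, ψ n y • u n y) x := by
  obtain ⟨N, hN⟩ := hψ.exists_eventually_tsum_smul_eq hx u
  refine ContDiffAt.congr_of_eventuallyEq ?_ (hN.mono fun y hy ↦ hy.2)
  exact ContDiffAt.sum fun n _ ↦ (hψ.isCutoff n).contDiff.contDiffAt.smul (hu n)

theorem finitelyDeterminedAt_tsum_smul (hψ : IsFinitelyDeterminedPartition U V ψ) (hx : x ∈ U)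
    (hu : ∀ n, FinitelyDeterminedAt univ (u n) x) :
    FinitelyDeterminedAt univ (fun y ↦ ∑' n, ψ n y • u n y) x := by
  obtain ⟨N, hN⟩ := hψ.exists_eventually_tsum_smul_eq hx u
  refine FinitelyDeterminedAt.congr ?_ (hN.mono fun y hy ↦ hy.2)
  exact .sum _ fun n _ ↦ ((hψ.isCutoff n).finitelyDeterminedAt x).map₂ (hu n) (· • ·)

theorem tsum_smul_sub_eventuallyEq (hψ : IsFinitelyDeterminedPartition U V ψ) (hx : x ∈ U)
    (u : ℕ → E → F) (f : E → F) :
    (fun y ↦ ∑' n, ψ n y • u n y - f y) =ᶠ[𝓝 x] fun y ↦ ∑' n, ψ n y • (u n y - f y) := by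
  obtain ⟨N, hN⟩ := hψ.exists_eventually_sum_eq_one x hx
  filter_upwards [hN] with y ⟨hzero, hsum⟩
  have hfinite (v : ℕ → F) : ∑' n, ψ n y • v n = ∑ n ∈ Finset.range N, ψ n y • v n :=
    tsum_eq_sum fun n hn ↦ by rw [hzero n (by simpa using hn), zero_smul]
  rw [hfinite, hfinite]
  simp only [smul_sub, Finset.sum_sub_distrib]
  rw [← Finset.sum_smul, hsum, one_smul]

theorem tsum_smul_pos (hψ : IsFinitelyDeterminedPartition U V ψ) (hx : x ∈ U) {κ : ℕ → ℝ}
    (hκ : ∀ n, 0 < κ n) : 0 < ∑' n, ψ n x • κ n := by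
  obtain ⟨N, hN⟩ := hψ.exists_eventually_tsum_smul_eq hx fun n _ ↦ κ n
  obtain ⟨hsum, heq⟩ := hN.self_of_nhds
  obtain ⟨n, hnN, hn⟩ : ∃ n ∈ Finset.range N, 0 < ψ n x :=
    Finset.exists_lt_of_sum_lt (by simp [hsum])
  rw [heq]
  exact Finset.sum_pos' (fun m _ ↦ mul_nonneg ((hψ.isCutoff m).nonneg x) (hκ m).le)
    ⟨n, hnN, mul_pos hn (hκ n)⟩

theorem norm_tsum_smul_le (hψ : IsFinitelyDeterminedPartition U V ψ) (hx : x ∈ U) {δ : ℝ}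
    (hu : ∀ n, x ∈ V n → ‖u n x‖ ≤ δ) : ‖∑' n, ψ n x • u n x‖ ≤ δ := by
  obtain ⟨N, hN⟩ := hψ.exists_eventually_tsum_smul_eq hx u
  obtain ⟨hsum, heq⟩ := hN.self_of_nhds
  calc ‖∑' n, ψ n x • u n x‖ = ‖∑ n ∈ Finset.range N, ψ n x • u n x‖ := by rw [heq]
    _ ≤ ∑ n ∈ Finset.range N, ψ n x * δ := norm_sum_le_of_le _ fun n _ ↦ by
        rw [norm_smul, Real.norm_of_nonneg ((hψ.isCutoff n).nonneg x)]
        by_cases hxn : x ∈ V n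
        · exact mul_le_mul_of_nonneg_left (hu n hxn) ((hψ.isCutoff n).nonneg x)
        · rw [hψ.apply_eq_zero hxn, zero_mul, zero_mul]
    _ = δ := by rw [← Finset.sum_mul, hsum, one_mul]

theorem fderiv_tsum_smul (hψ : IsFinitelyDeterminedPartition U V ψ) (hx : x ∈ U)
    (hu : ∀ n, DifferentiableAt ℝ (u n) x) :
    fderiv ℝ (fun y ↦ ∑' n, ψ n y • u n y) x =
      ∑' n, ψ n x • fderiv ℝ (u n) x + ∑' n, (fderiv ℝ (ψ n) x).smulRight (u n x) := by
  obtain ⟨N, hN⟩ := hψ.exists_eventually_sum_eq_one x hx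
  have hzero (n : ℕ) (hn : n ∉ Finset.range N) : ψ n =ᶠ[𝓝 x] fun _ ↦ 0 :=
    hN.mono fun y hy ↦ hy.1 n (by simpa using hn)
  have heq : (fun y ↦ ∑' n, ψ n y • u n y) =ᶠ[𝓝 x]
      fun y ↦ ∑ n ∈ Finset.range N, ψ n y • u n y :=
    hN.mono fun y hy ↦ tsum_eq_sum fun n hn ↦ by rw [hy.1 n (by simpa using hn), zero_smul]
  have hderiv : HasFDerivAt (fun y ↦ ∑ n ∈ Finset.range N, ψ n y • u n y)
      (∑ n ∈ Finset.range N, (ψ n x • fderiv ℝ (u n) x + (fderiv ℝ (ψ n) x).smulRight (u n x)))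
      x :=
    HasFDerivAt.fun_sum fun n _ ↦
      ((hψ.isCutoff n).contDiff.differentiable one_ne_zero x).hasFDerivAt.smul
        (hu n).hasFDerivAt
  rw [heq.fderiv_eq, hderiv.fderiv, Finset.sum_add_distrib, tsum_eq_sum fun n hn ↦ ?_,
    tsum_eq_sum fun n hn ↦ ?_]
  · rw [(hzero n hn).fderiv_eq, fderiv_fun_const, Pi.zero_apply,
      ContinuousLinearMap.zero_smulRight]
  · rw [(hzero n hn).eq_of_nhds, zero_smul]

theorem norm_fderiv_tsum_smul_le (hψ : IsFinitelyDeterminedPartition U V ψ) (hx : x ∈ U)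
    (hu : ∀ n, DifferentiableAt ℝ (u n) x) {δ δ' : ℝ} (hδ : 0 ≤ δ)
    (hsmall : ∀ n, x ∈ V n → ‖fderiv ℝ (ψ n) x‖ * ‖u n x‖ ≤ δ / 2 / 2 ^ n)
    (hderiv : ∀ n, x ∈ V n → ‖fderiv ℝ (u n) x‖ ≤ δ') :
    ‖fderiv ℝ (fun y ↦ ∑' n, ψ n y • u n y) x‖ ≤ δ' + δ := by
  rw [hψ.fderiv_tsum_smul hx hu]
  refine norm_add_le_of_le
    (hψ.norm_tsum_smul_le (u := fun n ↦ fderiv ℝ (u n)) hx hderiv)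
    (tsum_of_norm_bounded (hasSum_geometric_two' δ) fun n ↦ ?_)
  rw [ContinuousLinearMap.norm_smulRight_apply]
  by_cases hxn : x ∈ V n
  · exact hsmall n hxn
  · rw [(hψ.eventuallyEq_zero n x hxn).fderiv_eq, fderiv_fun_const, Pi.zero_apply, norm_zero,
      zero_mul]
    positivity

end IsFinitelyDeterminedPartition

end Partition

section Multipliers

variable {E : Type*} [NormedAddCommGroup E] [NormedSpace ℝ E]

theorem sum_abs_le_two_mul {ι : Type*} {A : Finset ι} {u : ι → ℝ} {c : ℝ}
    (hu : ∀ B ⊆ A, |∑ i ∈ B, u i| ≤ c) : ∑ i ∈ A, |u i| ≤ 2 * c := by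
  have hpos : ∑ i ∈ A with 0 ≤ u i, |u i| ≤ c := by
    rw [Finset.sum_congr rfl fun i hi ↦ abs_of_nonneg (Finset.mem_filter.1 hi).2]
    exact (le_abs_self _).trans (hu _ (Finset.filter_subset _ _))
  have hneg : ∑ i ∈ A with ¬0 ≤ u i, |u i| ≤ c := by
    rw [Finset.sum_congr rfl fun i hi ↦ abs_of_neg (not_le.1 (Finset.mem_filter.1 hi).2),
      Finset.sum_neg_distrib]
    exact (neg_le_abs _).trans (hu _ (Finset.filter_subset _ _))
  rw [← Finset.sum_filter_add_sum_filter_not A fun i ↦ 0 ≤ u i]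
  linarith

theorem norm_sum_smul_coord_le [CompleteSpace E] {β : Type*}
    (b : UnconditionalSchauderBasis β ℝ E) {A : Finset β} {a : β → ℝ} {M : ℝ}
    (ha : ∀ i ∈ A, |a i| ≤ M) (hM : 0 ≤ M) (x : E) :
    ‖∑ i ∈ A, a i • b.coord i x • b i‖ ≤ 2 * b.nnnormProjBound * M * ‖x‖ := by
  refine NormedSpace.norm_le_dual_bound ℝ _ (by positivity) fun f ↦ ?_
  have hproj (B : Finset β) :
      |∑ i ∈ B, f (b.coord i x • b i)| ≤ ‖f‖ * (b.nnnormProjBound * ‖x‖) := by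
    rw [← map_sum, ← GeneralSchauderBasis.proj_apply]
    exact f.le_opNorm_of_le ((b.proj B).le_of_opNorm_le (b.norm_proj_le_nnnormProjBound B) x)
  calc ‖f (∑ i ∈ A, a i • b.coord i x • b i)‖
      = |∑ i ∈ A, a i * f (b.coord i x • b i)| := by
        simp only [map_sum, map_smul, smul_eq_mul, Real.norm_eq_abs]
    _ ≤ ∑ i ∈ A, |a i| * |f (b.coord i x • b i)| := by
        simpa only [abs_mul] using
          Finset.abs_sum_le_sum_abs (fun i ↦ a i * f (b.coord i x • b i)) A
    _ ≤ ∑ i ∈ A, M * |f (b.coord i x • b i)| :=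
        Finset.sum_le_sum fun i hi ↦ mul_le_mul_of_nonneg_right (ha i hi) (abs_nonneg _)
    _ = M * ∑ i ∈ A, |f (b.coord i x • b i)| := by rw [Finset.mul_sum]
    _ ≤ M * (2 * (‖f‖ * (b.nnnormProjBound * ‖x‖))) := by
        gcongr
        exact sum_abs_le_two_mul fun B _ ↦ hproj B
    _ = 2 * b.nnnormProjBound * M * ‖x‖ * ‖f‖ := by ring

variable (b : UnconditionalSchauderBasis ℕ ℝ E)

/-- The projection `x ↦ ∑_{i ≥ n} xᵢ eᵢ` onto a tail of the basis. -/
noncomputable def tailProj (n : ℕ) : E →L[ℝ] E :=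
  ContinuousLinearMap.id ℝ E - b.proj (Finset.range n)

theorem tailProj_apply (n : ℕ) (x : E) : tailProj b n x = x - b.proj (Finset.range n) x :=
  rfl

theorem coord_tailProj {n i : ℕ} (h : n ≤ i) (x : E) :
    b.coord i (tailProj b n x) = b.coord i x := by
  rw [tailProj_apply, map_sub, GeneralSchauderBasis.proj_apply, map_sum, sub_eq_self]
  refine Finset.sum_eq_zero fun j hj ↦ ?_
  have hij : i ≠ j := ((Finset.mem_range.1 hj).trans_le h).ne'
  have hortho : b.coord i (b j) = 0 := (b.ortho i j).trans (by simp [hij])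
  rw [map_smul, hortho, smul_zero]

theorem tendsto_proj_range (x : E) :
    Tendsto (fun n ↦ b.proj (Finset.range n) x) atTop (𝓝 x) := by
  have hx : HasSum (fun i ↦ b.coord i x • b i) x := b.expansion x
  simpa only [GeneralSchauderBasis.proj_apply] using hx.tendsto_sum_nat

theorem norm_tailProj_le [CompleteSpace E] (n : ℕ) :
    ‖tailProj b n‖ ≤ 1 + b.nnnormProjBound :=
  norm_sub_le_of_le ContinuousLinearMap.norm_id_le (b.norm_proj_le_nnnormProjBound _)

theorem exists_eventually_norm_tailProj_lt [CompleteSpace E] {r : ℝ} (hr : 0 < r) (x : E) :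
    ∃ N, ∀ᶠ y in 𝓝 x, ∀ n ≥ N, ‖tailProj b n y‖ < r := by
  have htail : Tendsto (fun n ↦ ‖tailProj b n x‖) atTop (𝓝 0) := by
    simpa [tailProj_apply] using ((tendsto_proj_range b x).const_sub x).norm
  obtain ⟨N, hN⟩ := eventually_atTop.1 (htail.eventually_lt_const (half_pos hr))
  have hcont : Tendsto (fun y ↦ (1 + b.nnnormProjBound : ℝ) * ‖y - x‖) (𝓝 x) (𝓝 0) :=
    Continuous.tendsto' (by fun_prop) _ _ (by simp)
  refine ⟨N, ?_⟩
  filter_upwards [hcont.eventually_lt_const (half_pos hr)] with y hy n hn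
  calc ‖tailProj b n y‖ = ‖tailProj b n x + tailProj b n (y - x)‖ := by
        rw [← map_add, add_sub_cancel]
    _ ≤ ‖tailProj b n x‖ + (1 + b.nnnormProjBound) * ‖y - x‖ :=
        norm_add_le_of_le le_rfl ((tailProj b n).le_of_opNorm_le (norm_tailProj_le b n) _)
    _ < r / 2 + r / 2 := add_lt_add (hN n hn) hy
    _ = r := add_halves r

theorem secondCountableTopology_of_basis (b : UnconditionalSchauderBasis ℕ ℝ E) :
    SecondCountableTopology E := by
  have hdense : closure (Submodule.span ℝ (range b) : Set E) = univ := by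
    refine eq_univ_of_forall fun x ↦ mem_closure_of_tendsto (tendsto_proj_range b x)
      (.of_forall fun n ↦ ?_)
    rw [GeneralSchauderBasis.proj_apply]
    exact Submodule.sum_mem _ fun i _ ↦
      Submodule.smul_mem _ _ (Submodule.subset_span (mem_range_self i))
  have hsep : TopologicalSpace.IsSeparable (univ : Set E) :=
    hdense ▸ ((countable_range b).isSeparable.span (R := ℝ)).closure
  have := TopologicalSpace.isSeparable_univ_iff.1 hsep
  exact UniformSpace.secondCountable_of_separable E

theorem norm_sum_smul_coord_le_of_tail [CompleteSpace E] {A : Finset ℕ} {a : ℕ → ℝ} {M s : ℝ}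
    {x : E} (ha : ∀ i ∈ A, |a i| ≤ M) (hM : 0 ≤ M) (hs : 0 ≤ s)
    (htail : ∀ i ∈ A, a i ≠ 0 → ‖tailProj b i x‖ ≤ s) :
    ‖∑ i ∈ A, a i • b.coord i x • b i‖ ≤ 2 * b.nnnormProjBound * M * s := by
  have hsupp : ∑ i ∈ A, a i • b.coord i x • b i =
      ∑ i ∈ A with a i ≠ 0, a i • b.coord i x • b i :=
    (Finset.sum_filter_of_ne fun i _ ↦ mt fun h ↦ by rw [h, zero_smul]).symm
  rw [hsupp]
  rcases Finset.eq_empty_or_nonempty {i ∈ A | a i ≠ 0} with hempty | hne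
  · rw [hempty, Finset.sum_empty, norm_zero]
    positivity
  -- Only the tail of `x` from the first index of the support on enters the sum.
  let n := Finset.min' _ hne
  obtain ⟨hnA, hn⟩ := Finset.mem_filter.1 (Finset.min'_mem _ hne)
  calc ‖∑ i ∈ A with a i ≠ 0, a i • b.coord i x • b i‖
      = ‖∑ i ∈ A with a i ≠ 0, a i • b.coord i (tailProj b n x) • b i‖ :=
        congrArg norm <| Finset.sum_congr rfl fun i hi ↦ by
          rw [coord_tailProj b (Finset.min'_le _ i hi)]
    _ ≤ 2 * b.nnnormProjBound * M * ‖tailProj b n x‖ :=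
        norm_sum_smul_coord_le b (fun i hi ↦ ha i (Finset.mem_filter.1 hi).1) hM _
    _ ≤ 2 * b.nnnormProjBound * M * s := by
        gcongr
        exact htail n hnA hn

end Multipliers

section TailCutoff

variable {E : Type*} [NormedAddCommGroup E] [NormedSpace ℝ E] {p : Seminorm ℝ E} {r : ℝ} {x : E}

/-- The identity of `E` is a uniform limit of `C¹` maps with a common bound `C` on their
derivatives that locally depend on finitely many functionals. -/
def HasFinitelyDeterminedIdApprox (E : Type*) [NormedAddCommGroup E] [NormedSpace ℝ E]
    (C : ℝ) : Prop :=
  ∀ s > 0, ∃ Φ : E → E, ContDiff ℝ 1 Φ ∧ (∀ x, FinitelyDeterminedAt univ Φ x) ∧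
    (∀ x, ‖Φ x - x‖ ≤ s) ∧ ∀ x, ‖fderiv ℝ Φ x‖ ≤ C

variable (b : UnconditionalSchauderBasis ℕ ℝ E)

/-- The factor by which `tailCutoff` multiplies the `i`-th coordinate of `x`: it vanishes if the
tail of `x` from `i` on has norm at most `r`, and is `1` if that norm is at least `2 r`. -/
noncomputable def tailWeight (p : Seminorm ℝ E) (r : ℝ) (i : ℕ) (x : E) : ℝ :=
  1 - normBump p r (tailProj b i x)

/-- The map `x ↦ ∑ wᵢ(x) xᵢ eᵢ`, where `wᵢ` is `tailWeight b p r i`; it forgets the small tails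
of `x`. -/
noncomputable def tailCutoff (p : Seminorm ℝ E) (r : ℝ) (x : E) : E :=
  ∑' i, tailWeight b p r i x • b.coord i x • b i

namespace tailWeight

theorem abs_le_one (i : ℕ) : |tailWeight b p r i x| ≤ 1 := by
  rw [tailWeight, abs_of_nonneg (sub_nonneg.2 normBump.le_one)]
  exact sub_le_self 1 normBump.nonneg

theorem contDiff (hp : IsEquivalentNorm p) (hC1 : IsC1Norm p) (hr : 0 < r) (i : ℕ) :
    ContDiff ℝ 1 (tailWeight b p r i) :=
  contDiff_const.sub ((normBump.contDiff hp hC1 hr).comp (tailProj b i).contDiff)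

theorem finitelyDeterminedAt (hp : IsEquivalentNorm p)
    (hfin : LocallyDependsOnFinitelyManyCoordinates p) (hr : 0 < r) (i : ℕ) (x : E) :
    FinitelyDeterminedAt univ (tailWeight b p r i) x :=
  ((normBump.finitelyDeterminedAt hp hfin hr _).comp_continuousLinearMap (tailProj b i)).map (1 - ·)

theorem exists_eventually_eq_zero [CompleteSpace E] (hp : IsEquivalentNorm p) (hr : 0 < r)
    (x : E) : ∃ N, ∀ᶠ y in 𝓝 x, ∀ i ≥ N, tailWeight b p r i y = 0 := by
  obtain ⟨c, C, -, hC, hpC⟩ := hp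
  obtain ⟨N, hN⟩ := exists_eventually_norm_tailProj_lt b (div_pos hr hC) x
  refine ⟨N, hN.mono fun y hy i hi ↦ sub_eq_zero.2 (normBump.eq_one hr ?_).symm⟩
  exact (hpC _).2.trans ((le_div_iff₀' hC).1 (hy i hi).le)

theorem exists_norm_fderiv_le [CompleteSpace E] (hp : IsEquivalentNorm p) :
    ∃ C : ℝ, 0 ≤ C ∧ ∀ r > 0, ∀ i x, ‖fderiv ℝ (tailWeight b p r i) x‖ ≤ C / r := by
  obtain ⟨C, hC, hlip⟩ := normBump.exists_abs_sub_le hp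
  refine ⟨C * (1 + b.nnnormProjBound), by positivity, fun r hr i x ↦
    norm_fderiv_le_of_lip' ℝ (by positivity) (.of_forall fun y ↦ ?_)⟩
  calc |tailWeight b p r i y - tailWeight b p r i x|
      = |normBump p r (tailProj b i x) - normBump p r (tailProj b i y)| := by
        rw [tailWeight, tailWeight, sub_sub_sub_cancel_left]
    _ ≤ C / r * ‖tailProj b i (x - y)‖ := by rw [map_sub]; exact hlip r hr _ _
    _ ≤ C / r * ((1 + b.nnnormProjBound) * ‖x - y‖) := by
        gcongr
        exact (tailProj b i).le_of_opNorm_le (norm_tailProj_le b i) _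
    _ = C * (1 + b.nnnormProjBound) / r * ‖y - x‖ := by rw [norm_sub_rev]; ring

theorem fderiv_eq_zero (hp : IsEquivalentNorm p) (hr : 0 < r) {i : ℕ}
    (hx : 2 * r < p (tailProj b i x)) : fderiv ℝ (tailWeight b p r i) x = 0 := by
  have hone : tailWeight b p r i =ᶠ[𝓝 x] fun _ ↦ 1 :=
    ((tailProj b i).continuous.continuousAt.eventually
      (normBump.eventuallyEq_zero hp hr hx)).mono fun y hy ↦ by rw [tailWeight, hy, sub_zero]
  rw [hone.fderiv_eq, fderiv_fun_const, Pi.zero_apply]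

end tailWeight

namespace tailCutoff

variable [CompleteSpace E]

theorem exists_eventually_eq_sum (hp : IsEquivalentNorm p) (hr : 0 < r) (x : E) :
    ∃ N, tailCutoff b p r =ᶠ[𝓝 x]
      fun y ↦ ∑ i ∈ Finset.range N, tailWeight b p r i y • b.coord i y • b i := by
  obtain ⟨N, hN⟩ := tailWeight.exists_eventually_eq_zero b hp hr x
  refine ⟨N, hN.mono fun y hy ↦ tsum_eq_sum fun i hi ↦ ?_⟩
  rw [hy i (by simpa using hi), zero_smul]

theorem contDiff (hp : IsEquivalentNorm p) (hC1 : IsC1Norm p) (hr : 0 < r) :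
    ContDiff ℝ 1 (tailCutoff b p r) := by
  refine contDiff_iff_contDiffAt.2 fun x ↦ ?_
  obtain ⟨N, hN⟩ := exists_eventually_eq_sum b hp hr x
  refine ContDiffAt.congr_of_eventuallyEq ?_ hN
  exact ContDiffAt.sum fun i _ ↦
    (tailWeight.contDiff b hp hC1 hr i).contDiffAt.smul (by fun_prop)

theorem finitelyDeterminedAt (hp : IsEquivalentNorm p)
    (hfin : LocallyDependsOnFinitelyManyCoordinates p) (hr : 0 < r) (x : E) :
    FinitelyDeterminedAt univ (tailCutoff b p r) x := by
  obtain ⟨N, hN⟩ := exists_eventually_eq_sum b hp hr x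
  refine FinitelyDeterminedAt.congr ?_ hN
  exact .sum _ fun i _ ↦ (tailWeight.finitelyDeterminedAt b hp hfin hr i x).map₂
    (.continuousLinearMap (b.coord i)) fun w t ↦ w • t • b i

theorem norm_sub_le (hp : IsEquivalentNorm p) {c : ℝ} (hc : 0 < c)
    (hcp : ∀ x, c * ‖x‖ ≤ p x) (hr : 0 < r) (x : E) :
    ‖tailCutoff b p r x - x‖ ≤ 2 * b.nnnormProjBound * (2 * r / c) := by
  have hcutoff :
      HasSum (fun i ↦ tailWeight b p r i x • b.coord i x • b i) (tailCutoff b p r x) := by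
    obtain ⟨N, hN⟩ := tailWeight.exists_eventually_eq_zero b hp hr x
    refine (summable_of_ne_finset_zero (s := Finset.range N) fun i hi ↦ ?_).hasSum
    rw [hN.self_of_nhds i (by simpa using hi), zero_smul]
  have hdiff : HasSum (fun i ↦ normBump p r (tailProj b i x) • b.coord i x • b i)
      (x - tailCutoff b p r x) := by
    simpa only [tailWeight, sub_smul, one_smul, sub_sub_cancel]
      using HasSum.sub (b.expansion x) hcutoff
  rw [norm_sub_rev]
  refine le_of_tendsto hdiff.norm (.of_forall fun A ↦ ?_)
  refine (norm_sum_smul_coord_le_of_tail b (M := 1) (s := 2 * r / c)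
    (fun i _ ↦ ?_) zero_le_one (by positivity) fun i _ hi ↦ ?_).trans_eq (by ring)
  · exact (abs_of_nonneg normBump.nonneg).trans_le normBump.le_one
  · rw [le_div_iff₀' hc]
    exact (hcp _).trans (not_lt.1 fun hlt ↦ hi (normBump.eq_zero hr hlt.le))

theorem exists_fderiv_apply (hp : IsEquivalentNorm p) (hC1 : IsC1Norm p) (hr : 0 < r) (x : E) :
    ∃ N, ∀ v, fderiv ℝ (tailCutoff b p r) x v =
      ∑ i ∈ Finset.range N, tailWeight b p r i x • b.coord i v • b i +
        ∑ i ∈ Finset.range N, fderiv ℝ (tailWeight b p r i) x v • b.coord i x • b i := by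
  obtain ⟨N, hN⟩ := exists_eventually_eq_sum b hp hr x
  have hterm (i : ℕ) : HasFDerivAt (fun y ↦ tailWeight b p r i y • b.coord i y • b i)
      (tailWeight b p r i x • (b.coord i).smulRight (b i) +
        (fderiv ℝ (tailWeight b p r i) x).smulRight (b.coord i x • b i)) x :=
    ((tailWeight.contDiff b hp hC1 hr i).differentiable one_ne_zero x).hasFDerivAt.smul
      ((b.coord i).smulRight (b i)).hasFDerivAt
  refine ⟨N, fun v ↦ ?_⟩
  rw [((HasFDerivAt.fun_sum fun i _ ↦ hterm i).congr_of_eventuallyEq hN).fderiv]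
  simp [Finset.sum_add_distrib]

theorem norm_fderiv_le (hp : IsEquivalentNorm p) (hC1 : IsC1Norm p) {c D : ℝ} (hc : 0 < c)
    (hcp : ∀ x, c * ‖x‖ ≤ p x) (hr : 0 < r) (hD : 0 ≤ D)
    (hDr : ∀ i, ‖fderiv ℝ (tailWeight b p r i) x‖ ≤ D / r) :
    ‖fderiv ℝ (tailCutoff b p r) x‖ ≤ 2 * b.nnnormProjBound * (1 + 2 * D / c) := by
  obtain ⟨N, hN⟩ := exists_fderiv_apply b hp hC1 hr x
  refine ContinuousLinearMap.opNorm_le_bound _ (by positivity) fun v ↦ ?_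
  rw [hN]
  calc _ ≤ 2 * b.nnnormProjBound * 1 * ‖v‖ +
        2 * b.nnnormProjBound * (D / r * ‖v‖) * (2 * r / c) := by
        refine norm_add_le_of_le
          (norm_sum_smul_coord_le b (fun i _ ↦ tailWeight.abs_le_one b i) zero_le_one v)
          (norm_sum_smul_coord_le_of_tail b (fun i _ ↦ ?_) (by positivity) (by positivity)
            fun i _ hi ↦ ?_)
        · exact ContinuousLinearMap.le_of_opNorm_le _ (hDr i) v
        · rw [le_div_iff₀' hc]
          refine (hcp _).trans (not_lt.1 fun hlt ↦ hi ?_)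
          rw [tailWeight.fderiv_eq_zero b hp hr hlt, zero_apply]
    _ = 2 * b.nnnormProjBound * (1 + 2 * D / c) * ‖v‖ := by field_simp

end tailCutoff

theorem exists_hasFinitelyDeterminedIdApprox [CompleteSpace E]
    (b : UnconditionalSchauderBasis ℕ ℝ E) (hp : IsEquivalentNorm p) (hC1 : IsC1Norm p)
    (hfin : LocallyDependsOnFinitelyManyCoordinates p) :
    ∃ C, HasFinitelyDeterminedIdApprox E C := by
  obtain ⟨D, hD, hDr⟩ := tailWeight.exists_norm_fderiv_le b hp
  have ⟨c, _, hc, _, hcC⟩ := hp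
  have hcp (x : E) : c * ‖x‖ ≤ p x := (hcC x).1
  refine ⟨2 * b.nnnormProjBound * (1 + 2 * D / c), fun s hs ↦ ?_⟩
  let K : ℝ := b.nnnormProjBound
  have hr : 0 < s * c / (4 * (K + 1)) := by positivity
  refine ⟨tailCutoff b p _, tailCutoff.contDiff b hp hC1 hr,
    tailCutoff.finitelyDeterminedAt b hp hfin hr, fun x ↦ ?_,
    fun x ↦ tailCutoff.norm_fderiv_le b hp hC1 hc hcp hr hD fun i ↦ hDr _ hr i x⟩
  calc _ ≤ 2 * K * (2 * (s * c / (4 * (K + 1))) / c) := tailCutoff.norm_sub_le b hp hc hcp hr x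
    _ = K / (K + 1) * s := by field_simp; ring
    _ ≤ s := mul_le_of_le_one_left hs.le ((div_le_one (by positivity)).2 (by linarith))

end TailCutoff

section IndependentFunctionals

section Span

variable {X : Type*} [NormedAddCommGroup X] [NormedSpace ℝ X] [CompleteSpace X] {s : Set X}

theorem finiteDimensional_of_span_countable_eq_top (hs : s.Countable)
    (hspan : Submodule.span ℝ s = ⊤) : FiniteDimensional ℝ X := by
  let W (A : {A : Set X | A.Finite ∧ A ⊆ s}) : Submodule ℝ X := Submodule.span ℝ A
  have hW (A) : FiniteDimensional ℝ (W A) := FiniteDimensional.span_of_finite ℝ A.2.1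
  have hcountable : Countable {A : Set X | A.Finite ∧ A ⊆ s} :=
    (countable_ofPred_finite_subset hs).to_subtype
  have hcover : ⋃ A, (W A : Set X) = univ := eq_univ_of_forall fun x ↦ by
    obtain ⟨A, hAs, hxA⟩ := Submodule.mem_span_finite_of_mem_span (hspan ▸ Submodule.mem_top)
    exact mem_iUnion.2 ⟨⟨A, A.finite_toSet, hAs⟩, hxA⟩
  obtain ⟨A, hA⟩ := nonempty_interior_of_iUnion_of_closed
    (fun A ↦ (W A).closed_of_finiteDimensional) hcover
  have htop : (W A).FG := Module.Finite.iff_fg.1 (hW A)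
  rw [(W A).eq_top_of_nonempty_interior' hA] at htop
  exact ⟨htop⟩

theorem not_finiteDimensional_of_isCompl_span (hX : ¬ FiniteDimensional ℝ X) (hs : s.Countable)
    {W : Submodule ℝ X} (hW : IsCompl (Submodule.span ℝ s) W) : ¬ FiniteDimensional ℝ W := by
  intro hfin
  obtain ⟨t, rfl⟩ : W.FG := Module.Finite.iff_fg.1 hfin
  refine hX (finiteDimensional_of_span_countable_eq_top (hs.union t.countable_toSet) ?_)
  rw [Submodule.span_union, hW.sup_eq_top]

theorem exists_linearIndependent_disjoint_span (hX : ¬ FiniteDimensional ℝ X) (hs : s.Countable)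
    (n : ℕ) : ∃ t : Fin n → X, LinearIndependent ℝ t ∧
      Disjoint (Submodule.span ℝ s) (Submodule.span ℝ (range t)) := by
  obtain ⟨W, hW⟩ := exists_isCompl (Submodule.span ℝ s)
  have hrank : (n : Cardinal) ≤ Module.rank ℝ W :=
    Cardinal.natCast_le_aleph0.trans <| not_lt.1 fun h ↦
      not_finiteDimensional_of_isCompl_span hX hs hW (Module.rank_lt_aleph0_iff.1 h)
  obtain ⟨t, ht⟩ := exists_linearIndependent_of_le_rank hrank
  refine ⟨fun i ↦ t i, ht.map' W.subtype W.ker_subtype, hW.disjoint.mono_right ?_⟩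
  exact Submodule.span_le.2 (range_subset_iff.2 fun i ↦ (t i).2)

end Span

variable {E F : Type*} [NormedAddCommGroup E] [NormedSpace ℝ E] [NormedAddCommGroup F]
  [NormedSpace ℝ F] {S : Set (StrongDual ℝ E)}

theorem not_finiteDimensional_strongDual (hE : ¬ FiniteDimensional ℝ E) :
    ¬ FiniteDimensional ℝ (StrongDual ℝ E) := fun _ ↦
  hE <| FiniteDimensional.of_injective
    (NormedSpace.inclusionInDoubleDualLi ℝ (E := E)).toLinearMap
    (NormedSpace.inclusionInDoubleDualLi ℝ).injective

/-- `T` remains onto when restricted to the common kernel of finitely many functionals from `S`. -/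
def SurjectiveOnKernels (S : Set (StrongDual ℝ E)) (T : E →L[ℝ] F) : Prop :=
  ∀ A : Finset (StrongDual ℝ E), ↑A ⊆ S → ∀ w, ∃ v, (∀ L ∈ A, L v = 0) ∧ T v = w

theorem SurjectiveOnKernels.smul {T : E →L[ℝ] F} (hT : SurjectiveOnKernels S T) {c : ℝ}
    (hc : c ≠ 0) : SurjectiveOnKernels S (c • T) := by
  intro A hA w
  obtain ⟨v, hv, hTv⟩ := hT A hA (c⁻¹ • w)
  exact ⟨v, hv, by rw [smul_apply, hTv, smul_inv_smul₀ hc]⟩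

theorem mem_span_of_forall_apply_eq_zero {A : Finset (StrongDual ℝ E)} {φ : StrongDual ℝ E}
    (hφ : ∀ v, (∀ L ∈ A, L v = 0) → φ v = 0) :
    φ ∈ Submodule.span ℝ (A : Set (StrongDual ℝ E)) := by
  have hmem : (φ : E →ₗ[ℝ] ℝ) ∈ Submodule.span ℝ (range fun L : A ↦ (L.1 : E →ₗ[ℝ] ℝ)) :=
    mem_span_of_iInf_ker_le_ker fun v hv ↦
      hφ v fun L hL ↦ LinearMap.mem_ker.1 ((Submodule.mem_iInf _).1 hv ⟨L, hL⟩)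
  obtain ⟨c, hc⟩ := (Submodule.mem_span_range_iff_exists_fun ℝ).1 hmem
  have hφ_eq : φ = ∑ L : A, c L • L.1 := by
    ext v
    simpa [sum_apply] using (LinearMap.congr_fun hc v).symm
  exact hφ_eq ▸ Submodule.sum_mem _ fun L _ ↦
    Submodule.smul_mem _ _ (Submodule.subset_span L.2)

variable [FiniteDimensional ℝ F]

theorem surjectiveOnKernels_of_comp_mem_span {T : E →L[ℝ] F}
    (hT : ∀ φ : StrongDual ℝ F, φ ∘L T ∈ Submodule.span ℝ S → φ = 0) :
    SurjectiveOnKernels S T := by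
  intro A hA w
  let K : Submodule ℝ E := ⨅ L : A, LinearMap.ker (L.1 : E →ₗ[ℝ] ℝ)
  have hK {v : E} : v ∈ K ↔ ∀ L ∈ A, L v = 0 := by
    simp [K, Submodule.mem_iInf]
  suffices htop : K.map (T : E →ₗ[ℝ] F) = ⊤ by
    obtain ⟨v, hv, hTv⟩ : w ∈ K.map (T : E →ₗ[ℝ] F) := htop ▸ Submodule.mem_top
    exact ⟨v, hK.1 hv, hTv⟩
  by_contra hne
  obtain ⟨φ, hφ, hle⟩ := Submodule.exists_le_ker_of_lt_top _ (lt_top_iff_ne_top.2 hne)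
  have hφT : φ.toContinuousLinearMap ∘L T ∈ Submodule.span ℝ S :=
    Submodule.span_mono hA <| mem_span_of_forall_apply_eq_zero fun v hv ↦
      hle (Submodule.mem_map_of_mem (hK.2 hv))
  exact hφ ((map_eq_zero_iff _ LinearMap.toContinuousLinearMap.injective).1 (hT _ hφT))

theorem exists_surjectiveOnKernels_of_countable (hE : ¬ FiniteDimensional ℝ E)
    (hS : S.Countable) : ∃ T : E →L[ℝ] F, ‖T‖ ≤ 1 ∧ SurjectiveOnKernels S T := by
  let e := Module.finBasis ℝ F
  obtain ⟨t, ht, hdisj⟩ := exists_linearIndependent_disjoint_span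
    (not_finiteDimensional_strongDual hE) hS (Module.finrank ℝ F)
  let T : E →L[ℝ] F := ∑ i, (t i).smulRight (e i)
  have hT (φ : StrongDual ℝ F) : φ ∘L T = ∑ i, φ (e i) • t i := by
    ext v
    simp [T, sum_apply, mul_comm]
  have hTS : SurjectiveOnKernels S T := surjectiveOnKernels_of_comp_mem_span fun φ hφ ↦ by
    have hsum : ∑ i, φ (e i) • t i = 0 := Submodule.disjoint_def.1 hdisj _ (hT φ ▸ hφ) <|
      Submodule.sum_mem _ fun i _ ↦
        Submodule.smul_mem _ _ (Submodule.subset_span (mem_range_self i))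
    exact ContinuousLinearMap.coe_injective
      (e.ext fun i ↦ Fintype.linearIndependent_iff.1 ht _ hsum i)
  refine ⟨(‖T‖ + 1)⁻¹ • T, ?_, hTS.smul (by positivity)⟩
  rw [norm_smul, norm_inv, Real.norm_of_nonneg (by positivity)]
  exact inv_mul_le_one_of_le₀ (by linarith) (by positivity)

end IndependentFunctionals

section LocalApproximation

variable {E F : Type*} [NormedAddCommGroup E] [NormedSpace ℝ E] [NormedAddCommGroup F]
  [NormedSpace ℝ F] {f : E → F} {Φ : E → E} {D : E →L[ℝ] F} {x y : E} {η C : ℝ}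

theorem norm_comp_add_sub_le_of_norm_fderiv_sub_le {s : Set E} (hs : Convex ℝ s)
    (hf : Differentiable ℝ f) (hD : ∀ z ∈ s, ‖fderiv ℝ f z - D‖ ≤ η) (hy : y ∈ s)
    (hΦy : Φ y ∈ s) : ‖f (Φ y) + (D y - D (Φ y)) - f y‖ ≤ η * ‖Φ y - y‖ := by
  have hrearrange : f (Φ y) + (D y - D (Φ y)) - f y = f (Φ y) - f y - D (Φ y - y) := by
    rw [map_sub]; abel
  rw [hrearrange]
  exact hs.norm_image_sub_le_of_norm_fderiv_le' (𝕜 := ℝ) (fun z _ ↦ hf z) hD hy hΦy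

theorem norm_fderiv_comp_add_sub_le (hf : Differentiable ℝ f) (hΦ : Differentiable ℝ Φ)
    (hΦC : ‖fderiv ℝ Φ y‖ ≤ C) (hy : ‖fderiv ℝ f y - D‖ ≤ η)
    (hΦy : ‖fderiv ℝ f (Φ y) - D‖ ≤ η) :
    ‖fderiv ℝ (fun z ↦ f (Φ z) + (D z - D (Φ z))) y - fderiv ℝ f y‖ ≤ η * C + η := by
  have hderiv : HasFDerivAt (fun z ↦ f (Φ z) + (D z - D (Φ z)))
      (fderiv ℝ f (Φ y) ∘L fderiv ℝ Φ y + (D - D ∘L fderiv ℝ Φ y)) y :=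
    ((hf (Φ y)).hasFDerivAt.comp y (hΦ y).hasFDerivAt).add
      (D.hasFDerivAt.sub (D.hasFDerivAt.comp y (hΦ y).hasFDerivAt))
  have hrearrange : fderiv ℝ f (Φ y) ∘L fderiv ℝ Φ y + (D - D ∘L fderiv ℝ Φ y) - fderiv ℝ f y =
      (fderiv ℝ f (Φ y) - D) ∘L fderiv ℝ Φ y - (fderiv ℝ f y - D) := by
    rw [ContinuousLinearMap.sub_comp]; abel
  rw [hderiv.fderiv, hrearrange]
  refine norm_sub_le_of_le ((ContinuousLinearMap.opNorm_comp_le _ _).trans ?_) hy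
  exact mul_le_mul hΦy hΦC (norm_nonneg _) ((norm_nonneg _).trans hy)

theorem eventually_norm_fderiv_sub_lt (hf : ContDiff ℝ 1 f) (x : E) (hη : 0 < η) :
    ∀ᶠ y in 𝓝 x, ‖fderiv ℝ f y - fderiv ℝ f x‖ < η := by
  simpa only [dist_eq_norm] using
    (hf.continuous_fderiv one_ne_zero).continuousAt.eventually (Metric.ball_mem_nhds _ hη)

/-- Composing `f` itself with an approximate identity `Φ` would not control the derivative, since
`DΦ` is merely bounded; composing the remainder `f - Df(x)` does, as its derivative is small. -/
theorem HasFinitelyDeterminedIdApprox.exists_local_approximation [FiniteDimensional ℝ F]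
    (hid : HasFinitelyDeterminedIdApprox E C) (hf : ContDiff ℝ 1 f) (x : E) (hη : 0 < η) :
    ∃ V ∈ 𝓝 x, ∀ κ > 0, ∃ g : E → F, ContDiff ℝ 1 g ∧ (∀ y, FinitelyDeterminedAt univ g y) ∧
      ∀ y ∈ V, ‖g y - f y‖ ≤ κ ∧ ‖fderiv ℝ g y - fderiv ℝ f y‖ ≤ η := by
  have hC : 0 ≤ C := by
    obtain ⟨Φ, -, -, -, hΦC⟩ := hid 1 one_pos
    exact (norm_nonneg _).trans (hΦC 0)
  obtain ⟨η', hη', hη'C⟩ : ∃ η' > 0, η' * C + η' ≤ η :=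
    ⟨η / (C + 1), by positivity, le_of_eq (by field_simp)⟩
  set D := fderiv ℝ f x
  obtain ⟨R, hR, hball⟩ :=
    Metric.eventually_nhds_iff_ball.1 (eventually_norm_fderiv_sub_lt hf x hη')
  refine ⟨Metric.ball x (R / 2), Metric.ball_mem_nhds x (half_pos hR), fun κ hκ ↦ ?_⟩
  obtain ⟨Φ, hΦ, hΦfin, hΦid, hΦC⟩ := hid (min (R / 2) (κ / η')) (by positivity)
  refine ⟨fun y ↦ f (Φ y) + (D y - D (Φ y)),
    (hf.comp hΦ).add (D.contDiff.sub (D.contDiff.comp hΦ)),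
    fun y ↦ (hΦfin y).map₂ (.continuousLinearMap D) fun z w ↦ f z + (w - D z), fun y hy ↦ ?_⟩
  have hyR : y ∈ Metric.ball x R := Metric.ball_subset_ball (by linarith) hy
  have hΦR : Φ y ∈ Metric.ball x R := by
    have hΦy : dist (Φ y) y ≤ R / 2 := dist_eq_norm (Φ y) y ▸ (hΦid y).trans (min_le_left _ _)
    have := dist_triangle (Φ y) y x
    rw [Metric.mem_ball] at hy ⊢
    linarith
  constructor
  · calc ‖f (Φ y) + (D y - D (Φ y)) - f y‖ ≤ η' * ‖Φ y - y‖ :=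
          norm_comp_add_sub_le_of_norm_fderiv_sub_le (convex_ball x R)
            (hf.differentiable one_ne_zero) (fun z hz ↦ (hball z hz).le) hyR hΦR
      _ ≤ η' * (κ / η') := by gcongr; exact (hΦid y).trans (min_le_right _ _)
      _ = κ := mul_div_cancel₀ κ hη'.ne'
  · exact (norm_fderiv_comp_add_sub_le (hf.differentiable one_ne_zero)
      (hΦ.differentiable one_ne_zero) (hΦC y) (hball y hyR).le (hball _ hΦR).le).trans hη'C

end LocalApproximation

section GlobalApproximation

variable {E F : Type*} [NormedAddCommGroup E] [NormedSpace ℝ E] [SecondCountableTopology E]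
  [NormedAddCommGroup F] [NormedSpace ℝ F] {U : Set E} {δ : E → ℝ}

theorem HasFinitelyDeterminedCutoffs.exists_partition_and_tolerance
    (hcut : HasFinitelyDeterminedCutoffs E) (hU : U.Nonempty) (hδ : Continuous δ)
    (hδ_pos : ∀ x ∈ U, 0 < δ x) {V : E → Set E} (hV : ∀ x ∈ U, V x ∈ 𝓝 x) :
    ∃ (a : ℕ → E) (ψ : ℕ → E → ℝ) (κ : ℕ → ℝ),
      IsFinitelyDeterminedPartition U (fun n ↦ V (a n) ∩ {y | δ (a n) / 2 < δ y}) ψ ∧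
      ∀ n, a n ∈ U ∧ 0 < κ n ∧ ∀ y, δ (a n) / 2 < δ y →
        κ n ≤ δ y ∧ ‖fderiv ℝ (ψ n) y‖ * κ n ≤ δ y / 2 / 2 ^ n := by
  obtain ⟨a, ψ, haU, hψ⟩ := hcut.exists_partition hU
    (V := fun x ↦ V x ∩ {y | δ x / 2 < δ y}) fun x hx ↦ inter_mem (hV x hx)
      (hδ.continuousAt.eventually_const_lt (half_lt_self (hδ_pos x hx)))
  choose M hM using fun n ↦ (hψ.isCutoff n).exists_norm_fderiv_le
  have hM_nonneg (n : ℕ) : 0 ≤ M n := (norm_nonneg _).trans (hM n 0)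
  have ha_pos (n : ℕ) : 0 < δ (a n) := hδ_pos _ (haU n)
  refine ⟨a, ψ, fun n ↦ δ (a n) / 2 / 2 / 2 ^ n / (M n + 1), hψ, fun n ↦ ⟨haU n, ?_, ?_⟩⟩
  · have := ha_pos n
    have := hM_nonneg n
    positivity
  intro y hy
  have := ha_pos n
  have := hM_nonneg n
  constructor
  · calc δ (a n) / 2 / 2 / 2 ^ n / (M n + 1) ≤ δ (a n) / 2 / 2 / 2 ^ n :=
          div_le_self (by positivity) (by linarith)
      _ ≤ δ (a n) / 2 / 2 := div_le_self (by positivity) (one_le_pow₀ one_le_two)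
      _ ≤ δ y := by linarith
  · calc ‖fderiv ℝ (ψ n) y‖ * (δ (a n) / 2 / 2 / 2 ^ n / (M n + 1))
        ≤ (M n + 1) * (δ (a n) / 2 / 2 / 2 ^ n / (M n + 1)) := by
          gcongr
          linarith [hM n y]
      _ = δ (a n) / 2 / 2 / 2 ^ n := mul_div_cancel₀ _ (by positivity)
      _ ≤ δ y / 2 / 2 ^ n := by gcongr

theorem HasFinitelyDeterminedCutoffs.exists_pos_small (hcut : HasFinitelyDeterminedCutoffs E)
    (hδ : Continuous δ) (hδ_pos : ∀ x ∈ U, 0 < δ x) :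
    ∃ ρ : E → ℝ, ∀ x ∈ U, ContDiffAt ℝ 1 ρ x ∧ FinitelyDeterminedAt univ ρ x ∧
      0 < ρ x ∧ ρ x ≤ δ x ∧ ‖fderiv ℝ ρ x‖ ≤ δ x := by
  rcases U.eq_empty_or_nonempty with rfl | hU
  · exact ⟨0, fun x hx ↦ hx.elim⟩
  obtain ⟨a, ψ, κ, hψ, hκ⟩ := hcut.exists_partition_and_tolerance hU hδ hδ_pos
    fun _ _ ↦ univ_mem
  refine ⟨fun y ↦ ∑' n, ψ n y • κ n, fun x hx ↦ ⟨?_, ?_, ?_, ?_, ?_⟩⟩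
  · exact hψ.contDiffAt_tsum_smul (u := fun n _ ↦ κ n) hx fun n ↦ contDiffAt_const
  · exact hψ.finitelyDeterminedAt_tsum_smul (u := fun n _ ↦ κ n) hx fun n ↦ .const _
  · exact hψ.tsum_smul_pos hx fun n ↦ (hκ n).2.1
  · refine (le_abs_self _).trans (hψ.norm_tsum_smul_le (u := fun n _ ↦ κ n) hx fun n hn ↦ ?_)
    rw [Real.norm_of_nonneg (hκ n).2.1.le]
    exact ((hκ n).2.2 x hn.2).1
  · refine (hψ.norm_fderiv_tsum_smul_le (u := fun n _ ↦ κ n) (δ' := 0) hx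
      (fun n ↦ differentiableAt_const _) (hδ_pos x hx).le (fun n hn ↦ ?_)
      fun n _ ↦ by rw [fderiv_fun_const, Pi.zero_apply, norm_zero]).trans_eq (zero_add _)
    rw [Real.norm_of_nonneg (hκ n).2.1.le]
    exact ((hκ n).2.2 x hn.2).2

theorem HasFinitelyDeterminedIdApprox.exists_approximation [FiniteDimensional ℝ F] {C : ℝ}
    (hid : HasFinitelyDeterminedIdApprox E C) (hcut : HasFinitelyDeterminedCutoffs E)
    {f : E → F} (hf : ContDiff ℝ 1 f) (hδ : Continuous δ) (hδ_pos : ∀ x ∈ U, 0 < δ x) :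
    ∃ g : E → F, ∀ x ∈ U, ContDiffAt ℝ 1 g x ∧ FinitelyDeterminedAt univ g x ∧
      ‖g x - f x‖ ≤ δ x ∧ ‖fderiv ℝ g x - fderiv ℝ f x‖ ≤ δ x := by
  rcases U.eq_empty_or_nonempty with rfl | hU
  · exact ⟨0, fun x hx ↦ hx.elim⟩
  choose! V hV g hg hgfin hgf using fun x (hx : x ∈ U) ↦
    hid.exists_local_approximation hf x (half_pos (half_pos (hδ_pos x hx)))
  obtain ⟨a, ψ, κ, hψ, hκ⟩ := hcut.exists_partition_and_tolerance hU (hδ.div_const 2)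
    (fun x hx ↦ half_pos (hδ_pos x hx)) hV
  choose haU hκ_pos hκδ using hκ
  let u (n : ℕ) : E → F := g (a n) (κ n)
  have hu (n : ℕ) : ContDiff ℝ 1 (u n) := hg _ (haU n) _ (hκ_pos n)
  have hdiff (n : ℕ) : Differentiable ℝ (u n) := (hu n).differentiable one_ne_zero
  have hfdiff : Differentiable ℝ f := hf.differentiable one_ne_zero
  have huf (n : ℕ) {y : E} (hy : y ∈ V (a n)) :
      ‖u n y - f y‖ ≤ κ n ∧ ‖fderiv ℝ (u n) y - fderiv ℝ f y‖ ≤ δ (a n) / 2 / 2 :=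
    hgf _ (haU n) _ (hκ_pos n) y hy
  refine ⟨fun y ↦ ∑' n, ψ n y • u n y, fun x hx ↦ ⟨?_, ?_, ?_, ?_⟩⟩
  · exact hψ.contDiffAt_tsum_smul hx fun n ↦ (hu n).contDiffAt
  · exact hψ.finitelyDeterminedAt_tsum_smul hx fun n ↦ hgfin _ (haU n) _ (hκ_pos n) x
  · rw [(hψ.tsum_smul_sub_eventuallyEq hx u f).eq_of_nhds]
    refine (hψ.norm_tsum_smul_le (u := fun n y ↦ u n y - f y) hx fun n hn ↦ ?_).trans
      (half_le_self (hδ_pos x hx).le)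
    exact (huf n hn.1).1.trans (hκδ n x hn.2).1
  · rw [← fderiv_fun_sub ((hψ.contDiffAt_tsum_smul hx fun n ↦ (hu n).contDiffAt).differentiableAt
      one_ne_zero) (hfdiff x), (hψ.tsum_smul_sub_eventuallyEq hx u f).fderiv_eq, ← add_halves (δ x)]
    refine hψ.norm_fderiv_tsum_smul_le hx (fun n ↦ (hdiff n x).sub (hfdiff x))
      (half_pos (hδ_pos x hx)).le (fun n hn ↦ ?_) fun n hn ↦ ?_
    · exact (mul_le_mul_of_nonneg_left (huf n hn.1).1 (norm_nonneg _)).trans (hκδ n x hn.2).2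
    · rw [fderiv_sub (hdiff n x) (hfdiff x)]
      exact (huf n hn.1).2.trans hn.2.le

end GlobalApproximation

section Perturbation

variable {E F : Type*} [NormedAddCommGroup E] [NormedSpace ℝ E] [NormedAddCommGroup F]
  [NormedSpace ℝ F] {S : Set (StrongDual ℝ E)} {f h : E → F} {ρ : E → ℝ} {T : E →L[ℝ] F}
  {U : Set E} {δ : E → ℝ} {x : E}

/-- On the common kernel of the functionals that determine `h` and `ρ` at `x`, the map `h + ρ T` is
affine near `x` with linear part `ρ x • T`. -/
theorem surjective_fderiv_add_smul (hT : SurjectiveOnKernels S T)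
    (hh : DifferentiableAt ℝ h x) (hρ : DifferentiableAt ℝ ρ x)
    (hfin : FinitelyDeterminedAt S (fun y ↦ (h y, ρ y)) x) (hρx : ρ x ≠ 0) :
    Function.Surjective (fderiv ℝ (fun y ↦ h y + ρ y • T y) x) := by
  intro w
  obtain ⟨A, hA, hline⟩ := hfin.exists_eventually_add_smul_eq
  obtain ⟨v, hv, hTv⟩ := hT A hA ((ρ x)⁻¹ • w)
  refine ⟨v, ?_⟩
  have hdiff : DifferentiableAt ℝ (fun y ↦ h y + ρ y • T y) x :=
    hh.add (hρ.smul T.differentiableAt)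
  have haffine : (fun r : ℝ ↦ h (x + r • v) + ρ (x + r • v) • T (x + r • v)) =ᶠ[𝓝 0]
      fun r ↦ h x + ρ x • T x + r • w := by
    filter_upwards [hline v hv] with r hr
    obtain ⟨hhr, hρr⟩ := Prod.mk.inj hr
    rw [hhr, hρr, map_add, map_smul, hTv, smul_add, smul_comm (ρ x) r, smul_inv_smul₀ hρx,
      add_assoc]
  have hderiv : HasDerivAt (fun r : ℝ ↦ h x + ρ x • T x + r • w) w 0 := by
    simpa only [one_smul, id] using ((hasDerivAt_id (0 : ℝ)).smul_const w).const_add _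
  exact (hdiff.hasFDerivAt.hasLineDerivAt v).unique (hderiv.congr_of_eventuallyEq haffine)

theorem norm_fderiv_smul_le {η : ℝ} (hT : ‖T‖ ≤ 1) (hρ : DifferentiableAt ℝ ρ x)
    (hρx : |ρ x| ≤ η) (hDρ : ‖fderiv ℝ ρ x‖ ≤ η) :
    ‖fderiv ℝ (fun y ↦ ρ y • T y) x‖ ≤ η * (1 + ‖x‖) := by
  rw [fderiv_fun_smul hρ T.differentiableAt, T.fderiv, mul_add]
  refine norm_add_le_of_le ?_ ?_
  · rw [norm_smul]
    exact mul_le_mul hρx hT (norm_nonneg _) ((abs_nonneg _).trans hρx)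
  · rw [ContinuousLinearMap.norm_smulRight_apply]
    exact mul_le_mul hDρ (T.le_of_opNorm_le hT x |>.trans_eq (one_mul _)) (norm_nonneg _)
      ((abs_nonneg _).trans hρx)

theorem HasFinitelyDeterminedIdApprox.exists_approximation_surjective_fderiv
    [SecondCountableTopology E] [FiniteDimensional ℝ F] (hE : ¬ FiniteDimensional ℝ E) {C : ℝ}
    (hid : HasFinitelyDeterminedIdApprox E C) (hcut : HasFinitelyDeterminedCutoffs E)
    (hf : ContDiff ℝ 1 f) (hδ : Continuous δ) (hδ_pos : ∀ x ∈ U, 0 < δ x) :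
    ∃ g : E → F, ∀ x ∈ U, ContDiffAt ℝ 1 g x ∧ ‖g x - f x‖ ≤ δ x ∧
      ‖fderiv ℝ g x - fderiv ℝ f x‖ ≤ δ x ∧ Function.Surjective (fderiv ℝ g x) := by
  obtain ⟨h, hh⟩ := hid.exists_approximation hcut hf (hδ.div_const 2)
    fun x hx ↦ half_pos (hδ_pos x hx)
  choose! hh_diff hh_fin hhf hDhf using hh
  obtain ⟨ρ, hρ⟩ := hcut.exists_pos_small (δ := fun x ↦ δ x / 2 / (1 + ‖x‖)) (U := U)
    (by fun_prop (disch := intro; positivity))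
    fun x hx ↦ by have := hδ_pos x hx; positivity
  choose! hρ_diff hρ_fin hρ_pos hρδ hDρδ using hρ
  obtain ⟨S, hS, hS_fin⟩ := FinitelyDeterminedAt.exists_countable
    fun x hx ↦ (hh_fin x hx).map₂ (hρ_fin x hx) Prod.mk
  obtain ⟨T, hT_norm, hT⟩ := exists_surjectiveOnKernels_of_countable (F := F) hE hS
  refine ⟨fun y ↦ h y + ρ y • T y, fun x hx ↦ ?_⟩
  have hh_diffAt : DifferentiableAt ℝ h x := (hh_diff x hx).differentiableAt one_ne_zero
  have hρ_diffAt : DifferentiableAt ℝ ρ x := (hρ_diff x hx).differentiableAt one_ne_zero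
  have hρx : |ρ x| ≤ δ x / 2 / (1 + ‖x‖) := (abs_of_pos (hρ_pos x hx)).trans_le (hρδ x hx)
  have hcancel : δ x / 2 / (1 + ‖x‖) * (1 + ‖x‖) = δ x / 2 :=
    div_mul_cancel₀ _ (by positivity)
  refine ⟨(hh_diff x hx).add ((hρ_diff x hx).smul T.contDiff.contDiffAt), ?_, ?_,
    surjective_fderiv_add_smul hT hh_diffAt hρ_diffAt (hS_fin x hx) (hρ_pos x hx).ne'⟩
  · have hρT : ‖ρ x • T x‖ ≤ δ x / 2 := by
      rw [norm_smul, ← hcancel]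
      refine mul_le_mul hρx ?_ (norm_nonneg _) ((abs_nonneg _).trans hρx)
      linarith [T.le_of_opNorm_le hT_norm x]
    rw [add_sub_right_comm, ← add_halves (δ x)]
    exact norm_add_le_of_le (hhf x hx) hρT
  · rw [fderiv_fun_add hh_diffAt (hρ_diffAt.fun_smul T.differentiableAt), add_sub_right_comm,
      ← add_halves (δ x)]
    refine norm_add_le_of_le (hDhf x hx) (hcancel ▸ ?_)
    exact norm_fderiv_smul_le hT_norm hρ_diffAt hρx (hDρδ x hx)

end Perturbation

section Extension

variable {E F : Type*} [NormedAddCommGroup E] [NormedSpace ℝ E] [NormedAddCommGroup F]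
  [NormedSpace ℝ F] {U : Set E} {δ : E → ℝ} {f g : E → F}

theorem exists_continuous_pos_le_dist_sq {X : Type*} [PseudoMetricSpace X] {U : Set X}
    (hU : IsOpen U) {ε : X → ℝ} (hε : Continuous ε) (hε_pos : ∀ x ∈ U, 0 < ε x) :
    ∃ δ : X → ℝ, Continuous δ ∧ (∀ x ∈ U, 0 < δ x) ∧ (∀ x, δ x ≤ ε x) ∧
      ∀ x ∉ U, ∀ y, δ y ≤ dist y x ^ 2 := by
  rcases Uᶜ.eq_empty_or_nonempty with hcompl | hcompl
  · rw [compl_empty_iff] at hcompl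
    exact ⟨ε, hε, hε_pos, fun _ ↦ le_rfl, fun x hx ↦ (hx (hcompl ▸ mem_univ x)).elim⟩
  refine ⟨fun x ↦ min (ε x) (Metric.infDist x Uᶜ ^ 2),
    hε.min ((Metric.continuous_infDist_pt _).pow 2), fun x hx ↦ ?_, fun x ↦ min_le_left _ _,
    fun x hx y ↦ (min_le_right _ _).trans ?_⟩
  · have hdist : 0 < Metric.infDist x Uᶜ :=
      (hU.isClosed_compl.notMem_iff_infDist_pos hcompl).1 (notMem_compl_iff.2 hx)
    exact lt_min (hε_pos x hx) (by positivity)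
  · exact pow_le_pow_left₀ Metric.infDist_nonneg (Metric.infDist_le_dist_of_mem hx) 2

theorem norm_sub_le_dist_sq {X G : Type*} [PseudoMetricSpace X] [SeminormedAddCommGroup G]
    {U : Set X} {δ : X → ℝ} {u v : X → G} (hδ : ∀ x ∉ U, ∀ y, δ y ≤ dist y x ^ 2)
    (huv : ∀ x ∉ U, u x = v x) (huvδ : ∀ x ∈ U, ‖u x - v x‖ ≤ δ x) {x : X} (hx : x ∉ U) (y : X) :
    ‖u y - v y‖ ≤ dist y x ^ 2 := by
  by_cases hy : y ∈ U
  · exact (huvδ y hy).trans (hδ x hx y)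
  · rw [huv y hy, sub_self, norm_zero]
    positivity

theorem hasFDerivAt_of_norm_sub_le_dist_sq {x : E} (hf : DifferentiableAt ℝ f x)
    (hx : g x = f x) (hgf : ∀ y, ‖g y - f y‖ ≤ dist y x ^ 2) :
    HasFDerivAt g (fderiv ℝ f x) x := by
  have hbigO : (fun y ↦ g y - f y) =O[𝓝 x] fun y ↦ ‖y - x‖ ^ 2 :=
    .of_bound 1 (Eventually.of_forall fun y ↦ by simpa [dist_eq_norm] using hgf y)
  have hsub : HasFDerivAt (fun y ↦ g y - f y) (0 : E →L[ℝ] F) x := by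
    refine .of_isLittleO ?_
    simpa [hx] using hbigO.trans_isLittleO (Asymptotics.isLittleO_pow_sub_sub x one_lt_two)
  simpa using hsub.fun_add hf.hasFDerivAt

theorem continuousAt_of_norm_sub_le_dist_sq {X G : Type*} [PseudoMetricSpace X]
    [SeminormedAddCommGroup G] {u v : X → G} {x : X} (hv : ContinuousAt v x) (hx : u x = v x)
    (huv : ∀ y, ‖u y - v y‖ ≤ dist y x ^ 2) : ContinuousAt u x := by
  have hdist : Tendsto (fun y ↦ dist y x ^ 2) (𝓝 x) (𝓝 0) :=
    Continuous.tendsto' (by fun_prop) _ _ (by simp)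
  have hsub : Tendsto (fun y ↦ u y - v y) (𝓝 x) (𝓝 0) := squeeze_zero_norm huv hdist
  simpa [ContinuousAt, hx] using hsub.add hv

theorem contDiff_of_le_dist_sq (hf : ContDiff ℝ 1 f) (hδ : ∀ x ∉ U, ∀ y, δ y ≤ dist y x ^ 2)
    (hgf : ∀ x ∉ U, g x = f x) (hg : ∀ x ∈ U, ContDiffAt ℝ 1 g x)
    (hgδ : ∀ x ∈ U, ‖g x - f x‖ ≤ δ x)
    (hDgδ : ∀ x ∈ U, ‖fderiv ℝ g x - fderiv ℝ f x‖ ≤ δ x) :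
    ContDiff ℝ 1 g ∧ ∀ x ∉ U, fderiv ℝ g x = fderiv ℝ f x := by
  have hderiv (x) (hx : x ∉ U) : HasFDerivAt g (fderiv ℝ f x) x :=
    hasFDerivAt_of_norm_sub_le_dist_sq (hf.differentiable one_ne_zero x) (hgf x hx)
      (norm_sub_le_dist_sq hδ hgf hgδ hx)
  have hDgf (x) (hx : x ∉ U) : fderiv ℝ g x = fderiv ℝ f x := (hderiv x hx).fderiv
  refine ⟨contDiff_one_iff_fderiv.2 ⟨fun x ↦ ?_, continuous_iff_continuousAt.2 fun x ↦ ?_⟩,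
    hDgf⟩ <;> by_cases hx : x ∈ U
  · exact (hg x hx).differentiableAt one_ne_zero
  · exact (hderiv x hx).differentiableAt
  · exact ((hg x hx).fderiv_right (m := 0) (by norm_num)).continuousAt
  · exact continuousAt_of_norm_sub_le_dist_sq
      (hf.continuous_fderiv one_ne_zero).continuousAt (hDgf x hx)
      (norm_sub_le_dist_sq hδ hDgf hDgδ hx)

theorem exists_contDiff_eventuallyEq_of_le_dist_sq (hU : IsOpen U) (hf : ContDiff ℝ 1 f)
    (hδ : ∀ x ∉ U, ∀ y, δ y ≤ dist y x ^ 2) (hg : ∀ x ∈ U, ContDiffAt ℝ 1 g x)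
    (hgf : ∀ x ∈ U, ‖g x - f x‖ ≤ δ x)
    (hDgf : ∀ x ∈ U, ‖fderiv ℝ g x - fderiv ℝ f x‖ ≤ δ x) :
    ∃ φ : E → F, ContDiff ℝ 1 φ ∧ (∀ x ∈ U, φ =ᶠ[𝓝 x] g) ∧
      ∀ x ∉ U, φ x = f x ∧ fderiv ℝ φ x = fderiv ℝ f x := by
  classical
  have hφg (x) (hx : x ∈ U) : U.piecewise g f =ᶠ[𝓝 x] g :=
    (U.piecewise_eqOn g f).eventuallyEq_of_mem (hU.mem_nhds hx)
  have hφf (x) (hx : x ∉ U) : U.piecewise g f x = f x := U.piecewise_eq_of_notMem g f hx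
  obtain ⟨hφ, hDφf⟩ := contDiff_of_le_dist_sq hf hδ hφf
    (fun x hx ↦ (hg x hx).congr_of_eventuallyEq (hφg x hx))
    (fun x hx ↦ (hφg x hx).eq_of_nhds ▸ hgf x hx)
    (fun x hx ↦ (hφg x hx).fderiv_eq (𝕜 := ℝ) ▸ hDgf x hx)
  exact ⟨U.piecewise g f, hφ, hφg, fun x hx ↦ ⟨hφf x hx, hDφf x hx⟩⟩

end Extension

theorem theorem1p2_general {E F : Type*} [NormedAddCommGroup E] [NormedSpace ℝ E]
    [CompleteSpace E] [NormedAddCommGroup F] [NormedSpace ℝ F] [FiniteDimensional ℝ F]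
    (hinf : ¬ FiniteDimensional ℝ E)
    (hbasis : Nonempty (UnconditionalSchauderBasis ℕ ℝ E))
    (hnorm : ∃ p : Seminorm ℝ E, IsEquivalentNorm p ∧ IsC1Norm p ∧
      LocallyDependsOnFinitelyManyCoordinates p)
    (f : E → F) (hf : ContDiff ℝ 1 f)
    (ε : E → ℝ) (hε : Continuous ε) (hεpos : ∀ x, 0 < ε x)
    (U : Set E) (hU : IsOpen U) (hfU : criticalSet f ⊆ U) :
    ∃ φ : E → F, ContDiff ℝ 1 φ ∧
      (∀ x, ‖f x - φ x‖ ≤ ε x) ∧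
      (∀ x, x ∉ U → f x = φ x) ∧
      (∀ x, ‖fderiv ℝ f x - fderiv ℝ φ x‖ ≤ ε x) ∧
      (∀ x, Function.Surjective (fderiv ℝ φ x)) := by
  obtain ⟨b⟩ := hbasis
  obtain ⟨p, hp, hC1, hfin⟩ := hnorm
  have := secondCountableTopology_of_basis b
  obtain ⟨C, hid⟩ := exists_hasFinitelyDeterminedIdApprox b hp hC1 hfin
  obtain ⟨δ, hδ, hδ_pos, hδε, hδ_sq⟩ :=
    exists_continuous_pos_le_dist_sq hU hε fun x _ ↦ hεpos x
  obtain ⟨g, hg⟩ := hid.exists_approximation_surjective_fderiv hinf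
    (hasFinitelyDeterminedCutoffs hp hC1 hfin) hf hδ hδ_pos
  choose! hg_diff hgf hDgf hg_surj using hg
  obtain ⟨φ, hφ, hφg, hφf⟩ :=
    exists_contDiff_eventuallyEq_of_le_dist_sq hU hf hδ_sq hg_diff hgf hDgf
  refine ⟨φ, hφ, fun x ↦ ?_, fun x hx ↦ (hφf x hx).1.symm, fun x ↦ ?_, fun x ↦ ?_⟩ <;>
    by_cases hx : x ∈ U
  · rw [(hφg x hx).eq_of_nhds, norm_sub_rev]
    exact (hgf x hx).trans (hδε x)
  · rw [(hφf x hx).1, sub_self, norm_zero]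
    exact (hεpos x).le
  · rw [(hφg x hx).fderiv_eq, norm_sub_rev]
    exact (hDgf x hx).trans (hδε x)
  · rw [(hφf x hx).2, sub_self, norm_zero]
    exact (hεpos x).le
  · exact (hφg x hx).fderiv_eq (𝕜 := ℝ) ▸ hg_surj x hx
  · rw [(hφf x hx).2]
    exact of_not_not fun hcrit ↦ hx (hfU hcrit)

theorem theorem1p2 {E : Type*} [NormedAddCommGroup E] [NormedSpace ℝ E] [CompleteSpace E]
    (hinf : ¬ FiniteDimensional ℝ E)
    (hbasis : Nonempty (UnconditionalSchauderBasis ℕ ℝ E))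
    (hnorm : ∃ p : Seminorm ℝ E, IsEquivalentNorm p ∧ IsC1Norm p ∧
      LocallyDependsOnFinitelyManyCoordinates p)
    (d : ℕ) (f : E → EuclideanSpace ℝ (Fin d)) (hf : ContDiff ℝ 1 f)
    (ε : E → ℝ) (hε : Continuous ε) (hεpos : ∀ x, 0 < ε x)
    (U : Set E) (hU : IsOpen U) (hfU : criticalSet f ⊆ U) :
    ∃ φ : E → EuclideanSpace ℝ (Fin d), ContDiff ℝ 1 φ ∧
      (∀ x, ‖f x - φ x‖ ≤ ε x) ∧
      (∀ x, x ∉ U → f x = φ x) ∧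
      (∀ x, ‖fderiv ℝ f x - fderiv ℝ φ x‖ ≤ ε x) ∧
      (∀ x, Function.Surjective (fderiv ℝ φ x)) :=
  theorem1p2_general hinf hbasis hnorm f hf ε hε hεpos U hU hfU
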